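/- Let $\mathbb{D}\subset\mathbb{R}^2\cong\mathbb{C}$ be the open unit disk, with $z=x_1+ix_2$, and let $\|\cdot\|$ be the norm of the real space $L^2(\mathbb{D})$ (Lebesgue area measure). All derivatives of $L^2$-functions are taken in the sense of distributions on $\mathbb{D}$. Let $H^1(\mathbb{D})$ be the space of $f\in L^2(\mathbb{D})$ with $\partial f/\partial x_1,\partial f/\partial x_2\in L^2(\mathbb{D})$, normed by $\|f\|_1=\left(\|f\|^2+\|\partial f/\partial x_1\|^2+\|\partial f/\partial x_2\|^2\right)^{1/2}$. Let $P$ be the harmonic Bergman projection, that is, the orthogonal projection of $L^2(\mathbb{D})$ onto its closed subspace of square-integrable harmonic functions, and let $N=x_1\frac{\partial}{\partial x_1}+x_2\frac{\partial}{\partial x_2}=r\,\partial_r$. For integers $k\ge 0$ put $f_k(z)=\operatorname{Re}\left(z^{k+1}/|z|^k\right)$ for $z\neq 0$ and $f_k(0)=0$. Then, for every integer $k\ge 0$: $f_k\in L^2(\mathbb{D})$; $Nf_k=f_k$, both in the sense of distributions on $\mathbb{D}$ and classically at every $z\ne 0$; $\|f_k\|=\sqrt{\pi}/2$; and $$Pf_k(z)=2\,\frac{k+2}{k+4}\,\operatorname{Re}\left(z^{k+1}\right),$$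 in particular $Pf_k\in H^1(\mathbb{D})$. Moreover, there is no constant $C$ such that $$\|Pf_k\|_1\le C\left(\|Nf_k\|+\|f_k\|\right)\qquad\text{for all integers } k\ge 1.$$ Consequently, there is no constant $C$ such that $\|Pf\|_1\le C\left(\|Nf\|+\|f\|\right)$ holds for all $f\in L^2(\mathbb{D})$ with $Nf\in L^2(\mathbb{D})$ and $Pf\in H^1(\mathbb{D})$. -/

import Mathlib

open MeasureTheory Metric InnerProductSpace
open scoped ContDiff

noncomputable section

namespace HarmonicBergman

/-- The open unit disk; the plane is identified with `ℂ` by `z = x₁ + i x₂`. -/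
abbrev disk : Set ℂ := ball (0 : ℂ) 1

/-- The real Hilbert space `L²` of the disk, for the Euclidean area measure. -/
abbrev L2Disk : Type := Lp ℝ 2 ((volume : Measure ℂ).restrict disk)

/-- The space `h⁰` of square-integrable harmonic functions on the disk, inside `L²`. -/
def harmonicSpace : Submodule ℝ L2Disk where
  carrier := {f | ∃ u : ℂ → ℝ, HarmonicOnNhd u disk ∧ f =ᵐ[volume.restrict disk] u}
  zero_mem' := ⟨0, harmonicOnNhd_const 0, Lp.coeFn_zero _ _ _⟩
  add_mem' := by
    rintro f g ⟨u, hu, hfu⟩ ⟨v, hv, hgv⟩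
    exact ⟨u + v, hu.add hv, (Lp.coeFn_add f g).trans (hfu.add hgv)⟩
  smul_mem' := by
    rintro c f ⟨u, hu, hfu⟩
    exact ⟨c • u, hu.const_smul, (Lp.coeFn_smul c f).trans (hfu.const_smul c)⟩

/-! ### `h⁰` is a closed subspace, so that the orthogonal projection onto it exists -/

theorem harmonic_integral_ball {u : ℂ → ℝ} (hu : HarmonicOnNhd u disk) {z : ℂ} {ρ : ℝ}
    (hρ : 0 < ρ) (hz : closedBall z ρ ⊆ disk) :
    ∫ w in ball z ρ, u w = Real.pi * ρ ^ 2 * u z := by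
  have hmean : ∀ r ∈ Set.Ioo 0 ρ, ∫ θ in Set.Ioo (-Real.pi) Real.pi,
      r * u (circleMap z r θ) = r * (2 * Real.pi * u z) := by
    intro r hr
    have h1 : Real.circleAverage u z r = u z := by
      apply InnerProductSpace.HarmonicOnNhd.circleAverage_eq
      apply hu.mono
      rw [abs_of_pos hr.1]
      exact (closedBall_subset_closedBall hr.2.le).trans hz
    have hper : (fun θ ↦ u (circleMap z r θ)).Periodic (2 * Real.pi) :=
      fun x ↦ by simp [periodic_circleMap z r x]
    have h2 := hper.intervalIntegral_add_eq (-Real.pi) 0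
    rw [show -Real.pi + 2 * Real.pi = Real.pi by ring, zero_add] at h2
    rw [integral_const_mul, ← integral_Ioc_eq_integral_Ioo,
      ← intervalIntegral.integral_of_le (by linarith [Real.pi_pos]), h2]
    rw [Real.circleAverage_def, smul_eq_mul] at h1
    rw [← h1]
    field_simp
  have hmap : Continuous fun p : ℝ × ℝ ↦ circleMap z p.1 p.2 := by
    unfold circleMap; fun_prop
  have hint : IntegrableOn (fun p : ℝ × ℝ ↦ p.1 * u (circleMap z p.1 p.2))
      (Set.Ioo 0 ρ ×ˢ Set.Ioo (-Real.pi) Real.pi) := by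
    have : ContinuousOn (fun p : ℝ × ℝ ↦ p.1 * u (circleMap z p.1 p.2))
        (Set.Icc 0 ρ ×ˢ Set.Icc (-Real.pi) Real.pi) := by
      apply continuousOn_fst.mul
      apply hu.continuousOn.comp hmap.continuousOn
      rintro ⟨r, θ⟩ ⟨hr, -⟩
      apply hz
      simpa [circleMap, abs_of_nonneg hr.1] using hr.2
    exact (this.integrableOn_compact (isCompact_Icc.prod isCompact_Icc)).mono_set
      (Set.prod_mono Set.Ioo_subset_Icc_self Set.Ioo_subset_Icc_self)
  have key : ∫ w in ball z ρ, u w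
      = ∫ p in Set.Ioo 0 ρ ×ˢ Set.Ioo (-Real.pi) Real.pi, p.1 * u (circleMap z p.1 p.2) := by
    rw [← integral_indicator measurableSet_ball, ← integral_add_left_eq_self _ z,
      ← Complex.integral_comp_polarCoord_symm, polarCoord_target,
      ← integral_indicator (measurableSet_Ioi.prod measurableSet_Ioo),
      ← integral_indicator (measurableSet_Ioo.prod measurableSet_Ioo)]
    congr 1
    ext ⟨r, θ⟩
    have hc : z + Complex.polarCoord.symm (r, θ) = circleMap z r θ := by
      simp [circleMap, Complex.exp_mul_I]
    simp only [Set.indicator, Set.mem_prod, Set.mem_Ioi, Set.mem_Ioo, smul_eq_mul, hc]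
    by_cases h0 : 0 < r
    · by_cases h1 : r < ρ <;> simp [h0, h1, circleMap, abs_of_pos h0]
    · simp [h0]
  rw [key, Measure.volume_eq_prod, setIntegral_prod _ hint,
    setIntegral_congr_fun measurableSet_Ioo hmean, integral_mul_const,
    ← integral_Ioc_eq_integral_Ioo, ← intervalIntegral.integral_of_le hρ.le, integral_id]
  ring

theorem harmonic_eval_bound {R : ℝ} (hR : R < 1) :
    ∃ C : ℝ, ∀ (f : L2Disk) (u : ℂ → ℝ), HarmonicOnNhd u disk → f =ᵐ[volume.restrict disk] u →
      ∀ z ∈ closedBall (0 : ℂ) R, |u z| ≤ C * ‖f‖ := by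
  set ρ : ℝ := (1 - R) / 2 with hρd
  have hρ : 0 < ρ := by linarith
  set μ : Measure ℂ := volume.restrict disk with hμ
  have : IsFiniteMeasure μ :=
    isFiniteMeasure_restrict.2 measure_ball_lt_top.ne
  refine ⟨(Real.pi * ρ ^ 2)⁻¹ * (μ.real Set.univ) ^ (1 / (2 : ENNReal).toReal), ?_⟩
  intro f u hu hfu z hz
  have hsub : closedBall z ρ ⊆ disk := by
    intro w hw
    have h1 := dist_triangle w z 0
    simp only [mem_closedBall, mem_ball] at *
    linarith
  have h1 := harmonic_integral_ball hu hρ hsub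
  have hfin : μ (ball z ρ) ≠ ⊤ := measure_ne_top _ _
  have h2 := L2.inner_indicatorConstLp_one (𝕜 := ℝ) (μ := μ) measurableSet_ball hfin f
  have h3 : ∫ x in ball z ρ, f x ∂μ = ∫ w in ball z ρ, u w := by
    rw [Measure.restrict_restrict measurableSet_ball,
      Set.inter_eq_left.2 (ball_subset_closedBall.trans hsub)]
    apply integral_congr_ae
    exact ae_restrict_of_ae_restrict_of_subset (ball_subset_closedBall.trans hsub) hfu
  have h4 := abs_real_inner_le_norm (indicatorConstLp 2 measurableSet_ball hfin (1 : ℝ)) f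
  rw [h2, h3, h1, abs_mul, abs_of_pos (by positivity : 0 < Real.pi * ρ ^ 2)] at h4
  have h5 : ‖indicatorConstLp 2 measurableSet_ball hfin (1 : ℝ)‖
      ≤ (μ.real Set.univ) ^ (1 / (2 : ENNReal).toReal) := by
    refine norm_indicatorConstLp_le.trans ?_
    rw [norm_one, one_mul]
    exact Real.rpow_le_rpow measureReal_nonneg (measureReal_mono (Set.subset_univ _))
      (by positivity)
  rw [mul_assoc, inv_mul_eq_div, le_div_iff₀ (by positivity), mul_comm]
  exact h4.trans (mul_le_mul_of_nonneg_right h5 (norm_nonneg _))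

theorem isClosed_harmonicSpace : IsClosed (harmonicSpace : Set L2Disk) := by
  apply IsSeqClosed.isClosed
  intro F f hF hlim
  choose u hu hFu using hF
  have hcauchy : ∀ R < (1 : ℝ), UniformCauchySeqOn u Filter.atTop (closedBall (0 : ℂ) R) := by
    intro R hR
    obtain ⟨C, hC⟩ := harmonic_eval_bound hR
    rw [Metric.uniformCauchySeqOn_iff]
    intro ε hε
    obtain ⟨n₀, hn₀⟩ := Metric.cauchySeq_iff.1 hlim.cauchySeq (ε / (|C| + 1)) (by positivity)
    refine ⟨n₀, fun m hm n hn z hz ↦ ?_⟩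
    have h := hC (F m - F n) (u m - u n) ((hu m).sub (hu n))
      ((Lp.coeFn_sub _ _).trans ((hFu m).sub (hFu n))) z hz
    have h' := hn₀ m hm n hn
    rw [dist_eq_norm, lt_div_iff₀ (by positivity)] at h'
    rw [Real.dist_eq]
    refine lt_of_le_of_lt h ?_
    nlinarith [norm_nonneg (F m - F n), le_abs_self C]
  have hpt : ∀ z ∈ disk, ∃ l, Filter.Tendsto (fun n ↦ u n z) Filter.atTop (nhds l) := by
    intro z hz
    have hz' : ‖z‖ < 1 := by simpa using hz
    exact cauchySeq_tendsto_of_complete ((hcauchy ‖z‖ hz').cauchySeq (by simp))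
  choose! v hv using hpt
  have hvunif : ∀ R < (1 : ℝ), TendstoUniformlyOn u v Filter.atTop (closedBall (0 : ℂ) R) :=
    fun R hR ↦ (hcauchy R hR).tendstoUniformlyOn_of_tendsto
      fun z hz ↦ hv z (closedBall_subset_ball hR hz)
  refine ⟨v, ?_, ?_⟩
  · intro w₀ hw₀
    have hw₀' : ‖w₀‖ < 1 := by simpa using hw₀
    obtain ⟨R, hR₀, hR⟩ := exists_between hw₀'
    have hRpos : 0 < R := (norm_nonneg _).trans_lt hR₀
    have hsph : sphere (0 : ℂ) |R| ⊆ closedBall 0 R := by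
      rw [abs_of_pos hRpos]; exact sphere_subset_closedBall
    have hvc : ContinuousOn v (closedBall (0 : ℂ) R) :=
      (hvunif R hR).continuousOn (Filter.Frequently.of_forall fun n ↦
        (hu n).continuousOn.mono (closedBall_subset_ball hR))
    have hci : CircleIntegrable v 0 R := (hvc.mono hsph).circleIntegrable'
    have hci' : CircleIntegrable (fun ζ ↦ (v ζ : ℂ)) 0 R :=
      (Complex.continuous_ofReal.comp_continuousOn (hvc.mono hsph)).circleIntegrable'
    have han := analyticOnNhd_circleAverage_herglotzRieszKernel_smul hci'
    have heq : ∀ w ∈ ball (0 : ℂ) R, v w =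
        (Real.circleAverage (fun ζ ↦ herglotzRieszKernel 0 w ζ • (v ζ : ℂ)) 0 R).re := by
      intro w hw
      rw [re_circleAverage_herglotzRieszKernel_smul hci hw]
      have hk : Continuous fun θ ↦ (herglotzRieszKernel 0 w (circleMap 0 R θ)).re :=
        Complex.continuous_re.comp
          ((continuousOn_herglotzRieszKernel_sphere hw).comp_continuous (continuous_circleMap 0 R)
            fun θ ↦ circleMap_mem_sphere' 0 R θ)
      have h1 : ∀ n, u n w = Real.circleAverage
          ((Complex.re ∘ herglotzRieszKernel 0 w) • u n) 0 R := fun n ↦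
        (HarmonicOnNhd.circleAverage_re_herglotzRieszKernel_smul
          ((hu n).mono (closedBall_subset_ball hR)) hw).symm
      obtain ⟨C, hC⟩ := harmonic_eval_bound hR
      obtain ⟨M, hM⟩ := hlim.norm.bddAbove_range
      have hwd : w ∈ disk := ball_subset_ball hR.le hw
      refine tendsto_nhds_unique (hv w hwd) ?_
      simp_rw [h1, Real.circleAverage_def]
      apply Filter.Tendsto.const_smul
      refine intervalIntegral.tendsto_integral_filter_of_dominated_convergence
        (fun θ ↦ |(herglotzRieszKernel 0 w (circleMap 0 R θ)).re| * (|C| * M)) ?_ ?_ ?_ ?_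
      · refine Filter.Eventually.of_forall fun n ↦ ?_
        apply Continuous.aestronglyMeasurable
        refine hk.mul ((hu n).continuousOn.comp_continuous (continuous_circleMap 0 R) fun θ ↦ ?_)
        exact closedBall_subset_ball hR (hsph (circleMap_mem_sphere' 0 R θ))
      · refine Filter.Eventually.of_forall fun n ↦ Filter.Eventually.of_forall fun θ _ ↦ ?_
        have hb := hC (F n) (u n) (hu n) (hFu n) _ (hsph (circleMap_mem_sphere' 0 R θ))
        have hn : ‖F n‖ ≤ M := hM ⟨n, rfl⟩
        simp only [Pi.smul_apply', Function.comp_apply, smul_eq_mul, Real.norm_eq_abs, abs_mul]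
        refine mul_le_mul_of_nonneg_left (hb.trans ?_) (abs_nonneg _)
        exact (mul_le_mul_of_nonneg_right (le_abs_self C) (norm_nonneg _)).trans
          (mul_le_mul_of_nonneg_left hn (abs_nonneg _))
      · exact (hk.abs.mul continuous_const).intervalIntegrable _ _
      · refine Filter.Eventually.of_forall fun θ _ ↦ ?_
        exact (hv _ (closedBall_subset_ball hR
          (hsph (circleMap_mem_sphere' 0 R θ)))).const_mul _
    have hw₀R : w₀ ∈ ball (0 : ℂ) R := by simpa using hR₀
    refine (harmonicAt_congr_nhds ?_).2 (han w₀ hw₀R).harmonicAt_re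
    filter_upwards [isOpen_ball.mem_nhds hw₀R] with w hw using heq w hw
  · obtain ⟨ns, hns, hae⟩ := (tendstoInMeasure_of_tendsto_Lp hlim).exists_seq_tendsto_ae
    filter_upwards [hae, ae_all_iff.2 hFu, ae_restrict_mem measurableSet_ball] with z h1 h2 h3
    refine tendsto_nhds_unique h1 ?_
    simp_rw [h2]
    exact (hv z h3).comp hns.tendsto_atTop

instance : CompleteSpace harmonicSpace :=
  isClosed_harmonicSpace.completeSpace_coe

/-- The harmonic Bergman projection: the orthogonal projection of `L²` onto `h⁰`. -/
def P : L2Disk →L[ℝ] L2Disk := harmonicSpace.starProjection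

/-! ### Derivatives in the sense of distributions -/

/-- Real-valued smooth functions with compact support in the disk. -/
def IsTestFunction (φ : ℂ → ℝ) : Prop :=
  ContDiff ℝ ∞ φ ∧ HasCompactSupport φ ∧ tsupport φ ⊆ disk

/-- The divergence `∂₁Y₁ + ∂₂Y₂` of a vector field `Y = Y₁ + i Y₂`. -/
def divergence (Y : ℂ → ℂ) (z : ℂ) : ℝ :=
  (fderiv ℝ Y z 1).re + (fderiv ℝ Y z Complex.I).im

/-- For a smooth vector field `X = X₁ + i X₂`: the distributional derivative
`X₁ ∂₁f + X₂ ∂₂f` of `f ∈ L²` is (represented by) `g ∈ L²`. -/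
def HasDistribDeriv (X : ℂ → ℂ) (f g : L2Disk) : Prop :=
  ∀ φ : ℂ → ℝ, IsTestFunction φ →
    ∫ z in disk, g z * φ z = -∫ z in disk, f z * divergence (fun w ↦ φ w • X w) z

/-- The vector field `∂/∂x₁`. -/
def X₁ : ℂ → ℂ := fun _ ↦ 1

/-- The vector field `∂/∂x₂`. -/
def X₂ : ℂ → ℂ := fun _ ↦ Complex.I

/-- The vector field `N = x₁ ∂/∂x₁ + x₂ ∂/∂x₂ = r ∂/∂r`. -/
def N : ℂ → ℂ := fun z ↦ z

open Classical in
/-- The distributional derivative of `f` along `X` as an element of `L²`; it is meant for `f`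
such that this derivative belongs to `L²` (and is `0` for all other `f`). -/
def distribDeriv (X : ℂ → ℂ) (f : L2Disk) : L2Disk :=
  if h : ∃ g, HasDistribDeriv X f g then h.choose else 0

/-- `f` belongs to the Sobolev space `H¹` of the disk. -/
def MemH1 (f : L2Disk) : Prop :=
  (∃ g, HasDistribDeriv X₁ f g) ∧ ∃ g, HasDistribDeriv X₂ f g

/-- The Sobolev norm of order one, for `f` in `H¹`. -/
def sobolevNorm (f : L2Disk) : ℝ :=
  Real.sqrt (‖f‖ ^ 2 + ‖distribDeriv X₁ f‖ ^ 2 + ‖distribDeriv X₂ f‖ ^ 2)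

/-- The function `Re (z ^ (k + 1) / |z| ^ k)`, with the value `0` at `z = 0`. -/
def fk (k : ℕ) (z : ℂ) : ℝ := (z ^ (k + 1) / (‖z‖ : ℂ) ^ k).re

end HarmonicBergman

end

open HarmonicBergman

/-!
In polar coordinates `fk k` is `r cos ((k + 1) θ)`. It is homogeneous of degree one, so Euler's
identity gives `N (fk k) = fk k`, and its norm does not depend on `k`. The `n`-th Fourier mode of
a harmonic function on the circle of radius `r` is a fixed multiple of `r ^ n`. Hence a radial
multiple `w(|z|) Re (z ^ n)` is projected to the multiple of `Re (z ^ n)` with coefficient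
`(2 n + 2) ∫₀¹ w(r) r ^ (2 n + 1) dr`. For `fk k`, where `n = k + 1` and `w(r) = r ^ (-k)`, the
coefficients are at least `1`, while the norm of `∂₁ Re (z ^ (k + 1)) = (k + 1) Re (z ^ k)` grows
like `√k`. So `P (fk k)` is unbounded in `H¹` although `‖N (fk k)‖ + ‖fk k‖ = √π` for all `k`.
-/

namespace HarmonicBergman

/-! ### Polar coordinates on a disk -/

section PolarCoordinates

variable {E : Type*} [NormedAddCommGroup E] [NormedSpace ℝ E] {f : ℂ → E} {c : ℂ} {R : ℝ}

theorem integrableOn_comp_polarCoord_symm (hf : Integrable f) :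
    IntegrableOn (fun p : ℝ × ℝ ↦ p.1 • f (Complex.polarCoord.symm p)) polarCoord.target := by
  have hf' : Integrable (f ∘ Complex.measurableEquivRealProd.symm) :=
    (Complex.volume_preserving_equiv_real_prod.symm.integrable_comp_emb
      Complex.measurableEquivRealProd.symm.measurableEmbedding).2 hf
  refine ((integrableOn_image_iff_integrableOn_abs_det_fderiv_smul volume
    polarCoord.open_target.measurableSet
    (fun p _ ↦ (hasFDerivAt_polarCoord_symm p).hasFDerivWithinAt) polarCoord.symm.injOn _).1
    hf'.integrableOn).congr_fun ?_ polarCoord.open_target.measurableSet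
  rintro p ⟨hp : 0 < p.1, -⟩
  simp only [det_fderivPolarCoordSymm, abs_of_pos hp, Function.comp_apply,
    Complex.measurableEquivRealProd_symm_polarCoord_symm_apply]

theorem circleMap_eq_add_polarCoord_symm (c : ℂ) (p : ℝ × ℝ) :
    circleMap c p.1 p.2 = c + Complex.polarCoord.symm p := by
  simp [circleMap, Complex.exp_mul_I]

theorem smul_indicator_ball_comp_polarCoord_symm (f : ℂ → E) (c : ℂ) (R : ℝ) {p : ℝ × ℝ}
    (hp : p ∈ polarCoord.target) :
    p.1 • (ball c R).indicator f (c + Complex.polarCoord.symm p) =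
      (Set.Ioo 0 R ×ˢ Set.Ioo (-Real.pi) Real.pi).indicator
        (fun q ↦ q.1 • f (circleMap c q.1 q.2)) p := by
  obtain ⟨hr : 0 < p.1, hθ⟩ := hp
  have hmem : circleMap c p.1 p.2 ∈ ball c R ↔
      p ∈ Set.Ioo 0 R ×ˢ Set.Ioo (-Real.pi) Real.pi := by
    simp [mem_ball, dist_eq_norm, circleMap, Set.mem_prod, abs_of_pos hr, hr, hθ.1, hθ.2]
  rw [← circleMap_eq_add_polarCoord_symm]
  by_cases h : circleMap c p.1 p.2 ∈ ball c R
  · rw [Set.indicator_of_mem h, Set.indicator_of_mem (hmem.1 h)]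
  · rw [Set.indicator_of_notMem h, Set.indicator_of_notMem (hmem.not.1 h), smul_zero]

theorem polarRectangle_subset_target (R : ℝ) :
    Set.Ioo 0 R ×ˢ Set.Ioo (-Real.pi) Real.pi ⊆ polarCoord.target := by
  rw [polarCoord_target]
  exact Set.prod_mono Set.Ioo_subset_Ioi_self subset_rfl

theorem integrableOn_smul_circleMap (hf : IntegrableOn f (ball c R)) :
    IntegrableOn (fun p : ℝ × ℝ ↦ p.1 • f (circleMap c p.1 p.2))
      (Set.Ioo 0 R ×ˢ Set.Ioo (-Real.pi) Real.pi) := by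
  have hind : Integrable fun z ↦ (ball c R).indicator f (c + z) :=
    ((integrable_indicator_iff measurableSet_ball).2 hf).comp_add_left c
  refine ((integrableOn_comp_polarCoord_symm hind).mono_set
    (polarRectangle_subset_target R)).congr_fun (fun p hp ↦ ?_)
    (measurableSet_Ioo.prod measurableSet_Ioo)
  exact (smul_indicator_ball_comp_polarCoord_symm f c R
    (polarRectangle_subset_target R hp)).trans (Set.indicator_of_mem hp _)

theorem integral_ball_eq_integral_prod (f : ℂ → E) (c : ℂ) (R : ℝ) :
    ∫ z in ball c R, f z = ∫ p in Set.Ioo 0 R ×ˢ Set.Ioo (-Real.pi) Real.pi,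
      p.1 • f (circleMap c p.1 p.2) := by
  rw [← integral_indicator measurableSet_ball, ← integral_add_left_eq_self _ c,
    ← Complex.integral_comp_polarCoord_symm,
    setIntegral_congr_fun polarCoord.open_target.measurableSet
      fun p hp ↦ smul_indicator_ball_comp_polarCoord_symm f c R hp,
    setIntegral_indicator (measurableSet_Ioo.prod measurableSet_Ioo),
    Set.inter_eq_right.2 (polarRectangle_subset_target R)]

theorem integral_ball_eq_integral_radius_angle (hf : IntegrableOn f (ball c R)) :
    ∫ z in ball c R, f z = ∫ r in Set.Ioo 0 R, ∫ θ in Set.Ioo (-Real.pi) Real.pi,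
      r • f (circleMap c r θ) := by
  rw [integral_ball_eq_integral_prod, Measure.volume_eq_prod,
    setIntegral_prod _ (integrableOn_smul_circleMap hf)]

theorem integral_ball_eq_integral_angle_radius (hf : IntegrableOn f (ball c R)) :
    ∫ z in ball c R, f z = ∫ θ in Set.Ioo (-Real.pi) Real.pi, ∫ r in Set.Ioo 0 R,
      r • f (circleMap c r θ) := by
  rw [integral_ball_eq_integral_radius_angle hf]
  refine integral_integral_swap ?_
  rw [Measure.prod_restrict]
  exact integrableOn_smul_circleMap hf

theorem integral_Ioo_neg_pi_pi_circleMap (f : ℂ → E) (c : ℂ) (r : ℝ) :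
    ∫ θ in Set.Ioo (-Real.pi) Real.pi, f (circleMap c r θ) =
      (2 * Real.pi) • Real.circleAverage f c r := by
  rw [Real.circleAverage_eq_integral_add (-Real.pi), smul_inv_smul₀ Real.two_pi_pos.ne',
    intervalIntegral.integral_comp_add_right fun θ ↦ f (circleMap c r θ),
    ← integral_Ioc_eq_integral_Ioo,
    ← intervalIntegral.integral_of_le (by linarith [Real.pi_pos])]
  congr 1 <;> ring

theorem integral_ball_radial_smul {w : ℝ → ℝ}
    (hf : IntegrableOn (fun z ↦ w ‖z - c‖ • f z) (ball c R)) :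
    ∫ z in ball c R, w ‖z - c‖ • f z =
      (2 * Real.pi) • ∫ r in Set.Ioo 0 R, (r * w r) • Real.circleAverage f c r := by
  rw [integral_ball_eq_integral_radius_angle hf, ← integral_smul]
  refine setIntegral_congr_fun measurableSet_Ioo fun r hr ↦ ?_
  have hnorm (θ : ℝ) : ‖circleMap c r θ - c‖ = r := by
    simp [circleMap, abs_of_pos hr.1]
  simp only [hnorm, smul_smul]
  rw [integral_smul, integral_Ioo_neg_pi_pi_circleMap, smul_comm, smul_smul]

end PolarCoordinates

theorem integral_Ioo_zero_one_pow (m : ℕ) :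
    ∫ r in Set.Ioo (0 : ℝ) 1, r ^ m = 1 / ((m : ℝ) + 1) := by
  rw [← integral_Ioc_eq_integral_Ioo, ← intervalIntegral.integral_of_le zero_le_one,
    integral_pow]
  simp

/-! ### Fourier modes of harmonic functions on circles -/

section FourierModes

open scoped Nat ComplexConjugate

theorem circleAverage_mul_conj_pow {F : ℂ → ℂ} {c : ℂ} {r : ℝ} (hr : 0 < r)
    (hF : DiffContOnCl ℂ F (ball c r)) (n : ℕ) :
    Real.circleAverage (fun z ↦ F z * conj ((z - c) ^ n)) c r =
      ((r ^ (2 * n) : ℝ) : ℂ) * (iteratedDeriv n F c / n !) := by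
  have hconj : Set.EqOn (fun z ↦ (z - c)⁻¹ • (F z * conj ((z - c) ^ n)))
      (fun z ↦ ((r ^ (2 * n) : ℝ) : ℂ) • ((1 / (z - c) ^ (n + 1)) • F z)) (sphere c r) := by
    intro z hz
    have hnorm : ‖z - c‖ = r := mem_sphere_iff_norm.1 hz
    have hzc : z - c ≠ 0 := norm_ne_zero_iff.1 (hnorm ▸ hr.ne')
    have hmul : (z - c) ^ n * conj ((z - c) ^ n) = ((r ^ (2 * n) : ℝ) : ℂ) := by
      rw [Complex.mul_conj', norm_pow, hnorm, pow_mul']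
      push_cast
      rfl
    simp only [smul_eq_mul, ← hmul]
    field_simp
    ring
  rw [Real.circleAverage_eq_circleIntegral hr.ne', circleIntegral.integral_congr hr.le hconj,
    circleIntegral.integral_smul, hF.circleIntegral_one_div_sub_center_pow_smul hr n]
  simp only [smul_eq_mul]
  field_simp

/-- On the circle `|z - c| = r` one has `conj (z - c) = r² / (z - c)`, so if `u = Re F` then the
average of `u · Re (z - c) ^ n` picks out the `n`-th Taylor coefficient of `F`. -/
theorem exists_circleAverage_harmonic_mul_re_pow {u : ℂ → ℝ} {c : ℂ} {R : ℝ}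
    (hu : HarmonicOnNhd u (ball c R)) (n : ℕ) :
    ∃ a : ℝ, ∀ r ∈ Set.Ioo 0 R,
      Real.circleAverage (fun z ↦ u z * ((z - c) ^ n).re) c r = a * r ^ (2 * n) := by
  obtain ⟨F, hF, hFu⟩ := hu.exists_analyticOnNhd_ball_re_eq
  refine ⟨(F c * 0 ^ n + iteratedDeriv n F c / n !).re / 2, fun r hr ↦ ?_⟩
  have hsub : closedBall c r ⊆ ball c R := closedBall_subset_ball hr.2
  have hsph : sphere c |r| ⊆ ball c R := by
    rw [abs_of_pos hr.1]
    exact sphere_subset_closedBall.trans hsub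
  have hFr : DiffContOnCl ℂ F (ball c |r|) := by
    rw [abs_of_pos hr.1]
    exact ((hF.differentiableOn.mono hsub).mono closure_ball_subset_closedBall).diffContOnCl
  have hpow : DiffContOnCl ℂ (fun z ↦ (z - c) ^ n) (ball c |r|) :=
    (by fun_prop : Differentiable ℂ fun z : ℂ ↦ (z - c) ^ n).diffContOnCl
  have hint : CircleIntegrable (fun z ↦ F z * (z - c) ^ n) c r :=
    ((hF.continuousOn.mono hsph).mul (by fun_prop)).circleIntegrable'
  have hint_conj : CircleIntegrable (fun z ↦ F z * conj ((z - c) ^ n)) c r :=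
    ((hF.continuousOn.mono hsph).mul (by fun_prop)).circleIntegrable'
  have hmean : Real.circleAverage (fun z ↦ F z * (z - c) ^ n) c r =
      ((r ^ (2 * n) : ℝ) : ℂ) * (F c * 0 ^ n) := by
    have hcenter := (hFr.smul hpow).circleAverage
    simp only [smul_eq_mul] at hcenter
    rw [hcenter]
    rcases n with - | n <;> simp
  have hre : Set.EqOn (fun z ↦ u z * ((z - c) ^ n).re)
      (((1 / 2 : ℝ) • Complex.reCLM) ∘
        fun z ↦ F z * (z - c) ^ n + F z * conj ((z - c) ^ n)) (sphere c |r|) := by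
    intro z hz
    simp only [Function.comp_apply, ← hFu (hsph hz), ← mul_add, Complex.add_conj, smul_apply,
      Complex.reCLM_apply, smul_eq_mul, mul_comm (F z), Complex.re_ofReal_mul]
    ring
  rw [Real.circleAverage_congr_sphere hre,
    ContinuousLinearMap.circleAverage_comp_comm _ (by exact hint.add hint_conj),
    Real.circleAverage_fun_add hint hint_conj, hmean,
    circleAverage_mul_conj_pow hr.1 (by rwa [abs_of_pos hr.1] at hFr), ← mul_add, smul_apply,
    Complex.reCLM_apply, Complex.re_ofReal_mul, smul_eq_mul]
  ring

theorem exists_integral_ball_harmonic_mul_radial_mul_re_pow {u : ℂ → ℝ} {c : ℂ} {R : ℝ}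
    (hu : HarmonicOnNhd u (ball c R)) (n : ℕ) :
    ∃ a : ℝ, ∀ w : ℝ → ℝ,
      IntegrableOn (fun z ↦ u z * (w ‖z - c‖ * ((z - c) ^ n).re)) (ball c R) →
      ∫ z in ball c R, u z * (w ‖z - c‖ * ((z - c) ^ n).re) =
        a * ∫ r in Set.Ioo 0 R, w r * r ^ (2 * n + 1) := by
  obtain ⟨a, ha⟩ := exists_circleAverage_harmonic_mul_re_pow hu n
  refine ⟨2 * Real.pi * a, fun w hint ↦ ?_⟩
  have hcomm (z : ℂ) : u z * (w ‖z - c‖ * ((z - c) ^ n).re) =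
      w ‖z - c‖ • (u z * ((z - c) ^ n).re) := mul_left_comm _ _ _
  simp only [hcomm] at hint ⊢
  rw [integral_ball_radial_smul hint, smul_eq_mul, mul_assoc (2 * Real.pi),
    ← integral_const_mul a]
  congr 1
  refine setIntegral_congr_fun measurableSet_Ioo fun r hr ↦ ?_
  simp only [smul_eq_mul, ha r hr]
  ring

theorem circleAverage_re_pow_sq (c : ℂ) (r : ℝ) {n : ℕ} (hn : n ≠ 0) :
    Real.circleAverage (fun z ↦ ((z - c) ^ n).re ^ 2) c r = r ^ (2 * n) / 2 := by
  have hharm : Real.circleAverage (fun z ↦ ((z - c) ^ (2 * n)).re) c r = 0 := by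
    have : HarmonicOnNhd (fun z ↦ ((z - c) ^ (2 * n)).re) (closedBall c |r|) := fun z _ ↦
      ((analyticAt_id.sub analyticAt_const).pow (2 * n) : AnalyticAt ℂ _ z).harmonicAt_re
    simp [this.circleAverage_eq, hn]
  have hsq : Set.EqOn (fun z ↦ ((z - c) ^ n).re ^ 2)
      (fun z ↦ r ^ (2 * n) / 2 + (1 / 2 : ℝ) • ((z - c) ^ (2 * n)).re) (sphere c |r|) := by
    intro z hz
    have hnorm : ((z - c) ^ n).re * ((z - c) ^ n).re + ((z - c) ^ n).im * ((z - c) ^ n).im =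
        r ^ (2 * n) := by
      rw [← Complex.normSq_apply, ← Complex.sq_norm, norm_pow, mem_sphere_iff_norm.1 hz,
        ← pow_mul, mul_comm n, pow_mul, sq_abs, ← pow_mul]
    simp only [mul_comm 2 n, pow_mul (z - c), pow_two ((z - c) ^ n), Complex.mul_re,
      smul_eq_mul]
    rw [mul_comm n 2, ← hnorm]
    ring
  rw [Real.circleAverage_congr_sphere hsq, Real.circleAverage_fun_add, Real.circleAverage_const,
    Real.circleAverage_fun_smul, hharm, smul_zero, add_zero]
  · exact circleIntegrable_const _ _ _
  · exact (by fun_prop : Continuous fun z : ℂ ↦ (1 / 2 : ℝ) • ((z - c) ^ (2 * n)).re)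
      |>.continuousOn.circleIntegrable'

end FourierModes

/-! ### Radial multiples of `Re (z ^ n)` and their harmonic projections -/

section SquareIntegrable

variable {α : Type*} [MeasurableSpace α] {μ : Measure α} {f g : α → ℝ}

theorem integral_toLp_mul {p : ENNReal} (hf : MemLp f p μ) (h : α → ℝ) :
    ∫ x, hf.toLp f x * h x ∂μ = ∫ x, f x * h x ∂μ := by
  refine integral_congr_ae ?_
  filter_upwards [hf.coeFn_toLp] with x hx
  rw [hx]

theorem inner_toLp_toLp (hf : MemLp f 2 μ) (hg : MemLp g 2 μ) :
    inner ℝ (hf.toLp f) (hg.toLp g) = ∫ x, f x * g x ∂μ := by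
  rw [L2.inner_def]
  refine integral_congr_ae ?_
  filter_upwards [hf.coeFn_toLp, hg.coeFn_toLp] with x hfx hgx
  rw [hfx, hgx]
  exact mul_comm _ _

end SquareIntegrable

instance : IsFiniteMeasure ((volume : Measure ℂ).restrict disk) :=
  isFiniteMeasure_restrict.2 measure_ball_lt_top.ne

theorem memLp_of_continuous {f : ℂ → ℝ} (hf : Continuous f) :
    MemLp f 2 (volume.restrict disk) := by
  obtain ⟨C, hC⟩ := (isCompact_closedBall (0 : ℂ) 1).exists_bound_of_continuousOn hf.continuousOn
  refine MemLp.of_bound hf.aestronglyMeasurable C ?_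
  filter_upwards [ae_restrict_mem measurableSet_ball] with z hz
  exact hC z (ball_subset_closedBall hz)

theorem memLp_re_pow (n : ℕ) : MemLp (fun z : ℂ ↦ (z ^ n).re) 2 (volume.restrict disk) :=
  memLp_of_continuous (by fun_prop)

/-- The harmonic polynomial `Re (z ^ n)` as an element of `L²`. -/
noncomputable def reMonomial (n : ℕ) : L2Disk := (memLp_re_pow n).toLp _

theorem reMonomial_mem_harmonicSpace (n : ℕ) : reMonomial n ∈ harmonicSpace :=
  ⟨_, fun z _ ↦ (analyticAt_id.pow n : AnalyticAt ℂ _ z).harmonicAt_re,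
    (memLp_re_pow n).coeFn_toLp⟩

section RadialMultiple

variable {f : ℂ → ℝ} {w : ℝ → ℝ} {n : ℕ}

theorem norm_sq_toLp_of_eqOn_radial_mul_re_pow (hn : n ≠ 0)
    (hf : MemLp f 2 (volume.restrict disk))
    (hfw : Set.EqOn f (fun z ↦ w ‖z‖ * (z ^ n).re) disk) :
    ‖hf.toLp f‖ ^ 2 = Real.pi * ∫ r in Set.Ioo 0 1, w r ^ 2 * r ^ (2 * n + 1) := by
  have hsq : Set.EqOn (fun z ↦ f z ^ 2) (fun z ↦ w ‖z - 0‖ ^ 2 • ((z - 0) ^ n).re ^ 2) disk :=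
    fun z hz ↦ by simp only [hfw hz, mul_pow, sub_zero, smul_eq_mul]
  have hint := IntegrableOn.congr_fun hf.integrable_sq hsq measurableSet_ball
  rw [← real_inner_self_eq_norm_sq, inner_toLp_toLp]
  simp only [← pow_two]
  rw [setIntegral_congr_fun measurableSet_ball hsq,
    integral_ball_radial_smul (w := fun r ↦ w r ^ 2) hint, smul_eq_mul, mul_comm 2, mul_assoc,
    ← integral_const_mul]
  simp only [circleAverage_re_pow_sq _ _ hn, smul_eq_mul]
  congr 2 with r
  ring

theorem norm_sq_reMonomial (hn : n ≠ 0) : ‖reMonomial n‖ ^ 2 = Real.pi / (2 * n + 2) := by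
  rw [reMonomial, norm_sq_toLp_of_eqOn_radial_mul_re_pow (w := 1) hn _ fun z _ ↦ by simp]
  simp only [Pi.one_apply, one_pow, one_mul, integral_Ioo_zero_one_pow]
  push_cast
  ring

theorem exists_inner_toLp_harmonic {u : ℂ → ℝ} (hu : HarmonicOnNhd u disk)
    (hu2 : MemLp u 2 (volume.restrict disk)) (n : ℕ) :
    ∃ a : ℝ, ∀ (f : ℂ → ℝ) (w : ℝ → ℝ) (hf : MemLp f 2 (volume.restrict disk)),
      Set.EqOn f (fun z ↦ w ‖z‖ * (z ^ n).re) disk →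
      inner ℝ (hf.toLp f) (hu2.toLp u) = a * ∫ r in Set.Ioo 0 1, w r * r ^ (2 * n + 1) := by
  obtain ⟨a, ha⟩ := exists_integral_ball_harmonic_mul_radial_mul_re_pow hu n
  refine ⟨a, fun f w hf hfw ↦ ?_⟩
  have hprod : Set.EqOn (fun z ↦ u z * f z)
      (fun z ↦ u z * (w ‖z - 0‖ * ((z - 0) ^ n).re)) disk :=
    fun z hz ↦ by simp only [hfw hz, sub_zero]
  rw [real_inner_comm, inner_toLp_toLp, setIntegral_congr_fun measurableSet_ball hprod]
  exact ha w (IntegrableOn.congr_fun (hu2.integrable_mul hf) hprod measurableSet_ball)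

theorem P_toLp_of_eqOn_radial_mul_re_pow (hf : MemLp f 2 (volume.restrict disk))
    (hfw : Set.EqOn f (fun z ↦ w ‖z‖ * (z ^ n).re) disk) :
    P (hf.toLp f) =
      ((2 * n + 2) * ∫ r in Set.Ioo 0 1, w r * r ^ (2 * n + 1)) • reMonomial n := by
  refine Submodule.eq_starProjection_of_mem_of_inner_eq_zero
    (harmonicSpace.smul_mem _ (reMonomial_mem_harmonicSpace n)) ?_
  rintro g ⟨u, hu, hgu⟩
  have hu2 : MemLp u 2 (volume.restrict disk) := (Lp.memLp g).ae_eq hgu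
  obtain rfl : hu2.toLp u = g := Lp.ext (hu2.coeFn_toLp.trans hgu.symm)
  obtain ⟨a, ha⟩ := exists_inner_toLp_harmonic hu hu2 n
  have hmonomial : inner ℝ (reMonomial n) (hu2.toLp u) = a * (1 / (2 * n + 2)) := by
    rw [reMonomial, ha _ 1 _ fun z _ ↦ by simp]
    simp only [Pi.one_apply, one_mul, integral_Ioo_zero_one_pow]
    push_cast
    ring
  rw [inner_sub_left, real_inner_smul_left, ha f w hf hfw, hmonomial]
  field_simp
  ring

end RadialMultiple

/-! ### Distributional derivatives -/

section DistributionalDerivatives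

variable {X : ℂ → ℂ} {f g g' : L2Disk}

theorem HasDistribDeriv.unique (h : HasDistribDeriv X f g) (h' : HasDistribDeriv X f g') :
    g = g' := by
  have hint (g : L2Disk) : IntegrableOn g disk := (Lp.memLp g).integrable one_le_two
  have hzero : ∀ᵐ z, z ∈ disk → g z - g' z = 0 := by
    refine isOpen_ball.ae_eq_zero_of_integral_contDiff_smul_eq_zero
      ((hint g).sub (hint g')).locallyIntegrableOn fun φ hφ hc hs ↦ ?_
    have hφint (g : L2Disk) : IntegrableOn (fun z ↦ g z * φ z) disk :=
      (Lp.memLp g).integrable_mul (memLp_of_continuous hφ.continuous)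
    rw [← setIntegral_eq_integral_of_forall_compl_eq_zero (s := disk) fun z hz ↦ by
      rw [image_eq_zero_of_notMem_tsupport fun hz' ↦ hz (hs hz'), zero_smul]]
    simp only [smul_eq_mul, mul_comm (φ _), sub_mul]
    rw [integral_sub (hφint g) (hφint g'), h φ ⟨hφ, hc, hs⟩, h' φ ⟨hφ, hc, hs⟩, sub_self]
  refine Lp.ext ((ae_restrict_iff' measurableSet_ball).2 ?_)
  filter_upwards [hzero] with z hz hzd using sub_eq_zero.1 (hz hzd)

theorem HasDistribDeriv.distribDeriv_eq (h : HasDistribDeriv X f g) : distribDeriv X f = g := by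
  have hex : ∃ g, HasDistribDeriv X f g := ⟨g, h⟩
  rw [distribDeriv, dif_pos hex]
  exact hex.choose_spec.unique h

theorem HasDistribDeriv.const_smul (h : HasDistribDeriv X f g) (c : ℝ) :
    HasDistribDeriv X (c • f) (c • g) := by
  have hsmul (f : L2Disk) (ψ : ℂ → ℝ) :
      ∫ z in disk, (c • f : L2Disk) z * ψ z = c * ∫ z in disk, f z * ψ z := by
    rw [← integral_const_mul]
    refine integral_congr_ae ?_
    filter_upwards [Lp.coeFn_smul c f] with z hz
    rw [hz, Pi.smul_apply, smul_eq_mul, mul_assoc]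
  intro φ hφ
  rw [hsmul, hsmul, h φ hφ, mul_neg]

theorem MemH1.const_smul (h : MemH1 f) (c : ℝ) : MemH1 (c • f) :=
  ⟨h.1.elim fun _ h₁ ↦ ⟨_, h₁.const_smul c⟩, h.2.elim fun _ h₂ ↦ ⟨_, h₂.const_smul c⟩⟩

theorem norm_distribDeriv_X₁_le_sobolevNorm (f : L2Disk) :
    ‖distribDeriv X₁ f‖ ≤ sobolevNorm f :=
  Real.le_sqrt_of_sq_le (by nlinarith [sq_nonneg ‖f‖, sq_nonneg ‖distribDeriv X₂ f‖])

theorem hasDistribDeriv_toLp_iff {u v : ℂ → ℝ} (hu : MemLp u 2 (volume.restrict disk))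
    (hv : MemLp v 2 (volume.restrict disk)) :
    HasDistribDeriv X (hu.toLp u) (hv.toLp v) ↔ ∀ φ : ℂ → ℝ, IsTestFunction φ →
      ∫ z in disk, v z * φ z = -∫ z in disk, u z * divergence (fun w ↦ φ w • X w) z := by
  simp only [HasDistribDeriv, integral_toLp_mul]

end DistributionalDerivatives

section Divergence

variable {φ : ℂ → ℝ} {X Y : ℂ → ℂ} {z : ℂ}

theorem divergence_smul (hφ : DifferentiableAt ℝ φ z) (hX : DifferentiableAt ℝ X z) :
    divergence (fun w ↦ φ w • X w) z = fderiv ℝ φ z (X z) + φ z * divergence X z := by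
  have hXz : fderiv ℝ φ z (X z) =
      (X z).re * fderiv ℝ φ z 1 + (X z).im * fderiv ℝ φ z Complex.I := by
    conv_lhs => rw [show X z = (X z).re • (1 : ℂ) + (X z).im • Complex.I by
      simp [Complex.re_add_im]]
    simp only [map_add, map_smul, smul_eq_mul]
  rw [divergence, divergence, fderiv_fun_smul hφ hX, hXz]
  simp
  ring

theorem divergence_N (z : ℂ) : divergence N z = 2 := by
  have hN : fderiv ℝ N z = .id ℝ ℂ := fderiv_id
  simp [divergence, hN, one_add_one_eq_two]

theorem continuous_divergence (hY : ContDiff ℝ 1 Y) : Continuous (divergence Y) := by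
  have hderiv (v : ℂ) : Continuous fun z ↦ fderiv ℝ Y z v :=
    (hY.continuous_fderiv one_ne_zero).clm_apply continuous_const
  exact (Complex.continuous_re.comp (hderiv 1)).add (Complex.continuous_im.comp (hderiv Complex.I))

theorem divergence_eq_zero_of_notMem_tsupport (hz : z ∉ tsupport Y) : divergence Y z = 0 := by
  simp [divergence, fderiv_of_notMem_tsupport ℝ hz]

theorem integral_fderiv_apply_eq_zero {E : Type*} [NormedAddCommGroup E] [NormedSpace ℝ E]
    [FiniteDimensional ℝ E] [MeasurableSpace E] [BorelSpace E] {μ : Measure E}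
    [μ.IsAddHaarMeasure] {h : E → ℝ} (hh : ContDiff ℝ 1 h) (hc : HasCompactSupport h) (v : E) :
    ∫ x, fderiv ℝ h x v ∂μ = 0 := by
  have hderiv : Integrable (fun x ↦ fderiv ℝ h x v) μ :=
    ((hh.continuous_fderiv one_ne_zero).clm_apply continuous_const)
      |>.integrable_of_hasCompactSupport (hc.fderiv_apply ℝ v)
  simpa using integral_mul_fderiv_eq_neg_fderiv_mul_of_integrable (f := fun _ ↦ (1 : ℝ)) (g := h)
    (v := v) (μ := μ) (by simp) (by simpa using hderiv)
    (by simpa using hh.continuous.integrable_of_hasCompactSupport hc)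
    (fun _ _ ↦ differentiableAt_const _) (fun x _ ↦ hh.differentiable one_ne_zero x)

theorem integral_divergence_eq_zero (hY : ContDiff ℝ 1 Y) (hc : HasCompactSupport Y) :
    ∫ z, divergence Y z = 0 := by
  have hcomp (L : ℂ →L[ℝ] ℝ) (v : ℂ) :
      Integrable (fun z ↦ L (fderiv ℝ Y z v)) ∧ ∫ z, L (fderiv ℝ Y z v) = 0 := by
    have hL : ContDiff ℝ 1 (L ∘ Y) := L.contDiff.comp hY
    have hLc : HasCompactSupport (L ∘ Y) := hc.comp_left (map_zero L)
    have hfderiv (z : ℂ) : fderiv ℝ (L ∘ Y) z v = L (fderiv ℝ Y z v) := by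
      rw [fderiv_comp z L.differentiableAt (hY.differentiable one_ne_zero z), L.fderiv]
      rfl
    simp only [← hfderiv]
    exact ⟨((hL.continuous_fderiv one_ne_zero).clm_apply continuous_const)
      |>.integrable_of_hasCompactSupport (hLc.fderiv_apply ℝ v),
      integral_fderiv_apply_eq_zero hL hLc v⟩
  obtain ⟨hre, hre0⟩ := hcomp Complex.reCLM 1
  obtain ⟨him, him0⟩ := hcomp Complex.imCLM Complex.I
  exact (integral_add hre him).trans (by rw [hre0, him0, add_zero])

end Divergence

section ClassicalDerivatives

variable {u : ℂ → ℝ} {X : ℂ → ℂ}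

theorem hasDistribDeriv_of_contDiff (hu : ContDiff ℝ 1 u) (hX : ContDiff ℝ 1 X)
    (hu2 : MemLp u 2 (volume.restrict disk))
    (hXu : MemLp (fun z ↦ fderiv ℝ u z (X z)) 2 (volume.restrict disk)) :
    HasDistribDeriv X (hu2.toLp u) (hXu.toLp _) := by
  rw [hasDistribDeriv_toLp_iff]
  rintro φ ⟨hφ, hc, hs⟩
  have hφX : ContDiff ℝ 1 fun z ↦ φ z • X z := (hφ.of_le (by exact_mod_cast le_top)).smul hX
  set Y : ℂ → ℂ := fun z ↦ u z • φ z • X z with hY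
  have hYs : tsupport Y ⊆ tsupport φ :=
    (tsupport_smul_subset_right u _).trans (tsupport_smul_subset_left φ X)
  have hdiv (z : ℂ) : fderiv ℝ u z (X z) * φ z + u z * divergence (fun w ↦ φ w • X w) z =
      divergence Y z := by
    rw [hY, divergence_smul (hu.differentiable one_ne_zero z)
      (hφX.differentiable one_ne_zero z), map_smul, smul_eq_mul, mul_comm (φ z)]
  have hint : IntegrableOn (fun z ↦ fderiv ℝ u z (X z) * φ z) disk :=
    hXu.integrable_mul (memLp_of_continuous hφ.continuous)
  have hint' : IntegrableOn (fun z ↦ u z * divergence (fun w ↦ φ w • X w) z) disk :=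
    hu2.integrable_mul (memLp_of_continuous (continuous_divergence hφX))
  rw [eq_neg_iff_add_eq_zero, ← integral_add hint hint']
  simp only [hdiv]
  rw [setIntegral_eq_integral_of_forall_compl_eq_zero fun z hz ↦
    divergence_eq_zero_of_notMem_tsupport fun hz' ↦ hz (hs (hYs hz'))]
  exact integral_divergence_eq_zero (hu.smul hφX) (hc.mono' (subset_closure.trans hYs))

theorem memH1_of_contDiff (hu : ContDiff ℝ 1 u) (hu2 : MemLp u 2 (volume.restrict disk)) :
    MemH1 (hu2.toLp u) := by
  have hderiv (v : ℂ) : ∃ g, HasDistribDeriv (fun _ ↦ v) (hu2.toLp u) g :=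
    ⟨_, hasDistribDeriv_of_contDiff hu contDiff_const hu2
      (memLp_of_continuous ((hu.continuous_fderiv one_ne_zero).clm_apply continuous_const))⟩
  exact ⟨hderiv 1, hderiv Complex.I⟩

theorem contDiff_re_pow (n : ℕ) : ContDiff ℝ 1 fun z : ℂ ↦ (z ^ n).re :=
  Complex.reCLM.contDiff.comp (contDiff_id.pow n)

theorem memH1_reMonomial (n : ℕ) : MemH1 (reMonomial n) :=
  memH1_of_contDiff (contDiff_re_pow n) _

theorem hasDistribDeriv_X₁_reMonomial (n : ℕ) :
    HasDistribDeriv X₁ (reMonomial (n + 1)) (((n : ℝ) + 1) • reMonomial n) := by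
  have hderiv (z : ℂ) : fderiv ℝ (fun w : ℂ ↦ (w ^ (n + 1)).re) z (X₁ z) =
      ((n : ℝ) + 1) * (z ^ n).re := by
    have hpow : HasFDerivAt (fun w : ℂ ↦ w ^ (n + 1)) _ z :=
      ((hasDerivAt_pow (n + 1) z).hasFDerivAt).restrictScalars ℝ
    have hre : HasFDerivAt (fun w : ℂ ↦ (w ^ (n + 1)).re) _ z :=
      Complex.reCLM.hasFDerivAt.comp z hpow
    rw [hre.fderiv, ← Complex.re_ofReal_mul]
    simp [X₁]
  have hmem : MemLp (fun z ↦ fderiv ℝ (fun w : ℂ ↦ (w ^ (n + 1)).re) z (X₁ z)) 2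
      (volume.restrict disk) := by
    simpa only [hderiv] using (memLp_re_pow n).const_mul ((n : ℝ) + 1)
  have heq : hmem.toLp _ = ((n : ℝ) + 1) • reMonomial n := by
    simp only [hderiv]
    rfl
  rw [← heq]
  exact hasDistribDeriv_of_contDiff (contDiff_re_pow _) contDiff_const (memLp_re_pow _) hmem

end ClassicalDerivatives

/-! ### Euler's identity for homogeneous functions -/

section Homogeneous

variable {E : Type*} [NormedAddCommGroup E] [NormedSpace ℝ E] {a : ℝ} {f : E → ℝ}

/-- `f` is positively homogeneous of degree `a`. Only `t > 0` is considered, so that real degrees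
make sense. -/
def IsPosHomogeneous (a : ℝ) (f : E → ℝ) : Prop :=
  ∀ ⦃t : ℝ⦄, 0 < t → ∀ x, f (t • x) = t ^ a * f x

theorem IsPosHomogeneous.fderiv_self (hf : IsPosHomogeneous a f) {x : E}
    (hx : DifferentiableAt ℝ f x) : fderiv ℝ f x x = a * f x := by
  have hray : HasDerivAt (fun t : ℝ ↦ t • x) x 1 := by
    simpa using (hasDerivAt_id (1 : ℝ)).smul_const x
  have hfx : HasFDerivAt f (fderiv ℝ f x) ((1 : ℝ) • x) := by simpa using hx.hasFDerivAt
  have hchain : HasDerivAt (fun t : ℝ ↦ f (t • x)) (fderiv ℝ f x x) 1 :=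
    hfx.comp_hasDerivAt (1 : ℝ) hray
  have hpower : HasDerivAt (fun t : ℝ ↦ t ^ a * f x) (a * f x) 1 := by
    simpa using (Real.hasDerivAt_rpow_const (p := a) (.inl one_ne_zero)).mul_const (f x)
  refine hchain.unique (hpower.congr_of_eventuallyEq ?_)
  filter_upwards [lt_mem_nhds zero_lt_one] with t ht using hf ht x

theorem integral_Ioo_rpow_mul_add_fderiv_self {φ : E → ℝ} (hφ : ContDiff ℝ 1 φ) {s : ℝ}
    (hs : 0 < s) (x : E) :
    ∫ r in Set.Ioo (0 : ℝ) 1, r ^ (s - 1) * (s * φ (r • x) + fderiv ℝ φ (r • x) (r • x)) =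
      φ x := by
  have hray : Continuous fun r : ℝ ↦ r • x := by fun_prop
  have hderiv : ∀ r ∈ Set.Ioo (0 : ℝ) 1, HasDerivAt (fun r : ℝ ↦ r ^ s * φ (r • x))
      (r ^ (s - 1) * (s * φ (r • x) + fderiv ℝ φ (r • x) (r • x))) r := by
    intro r hr
    have hline : HasDerivAt (fun t : ℝ ↦ t • x) x r := by
      simpa using (hasDerivAt_id r).smul_const x
    have hφr : HasDerivAt (fun t : ℝ ↦ φ (t • x)) (fderiv ℝ φ (r • x) x) r :=
      (hφ.differentiable one_ne_zero (r • x)).hasFDerivAt.comp_hasDerivAt r hline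
    refine ((Real.hasDerivAt_rpow_const (p := s) (.inl hr.1.ne')).mul hφr).congr_deriv ?_
    rw [map_smul, smul_eq_mul, Real.rpow_sub_one hr.1.ne']
    have := hr.1.ne'
    field_simp
  have hcont : Continuous fun r : ℝ ↦ r ^ s * φ (r • x) :=
    (Real.continuous_rpow_const hs.le).mul (hφ.continuous.comp hray)
  have hint : IntervalIntegrable
      (fun r : ℝ ↦ r ^ (s - 1) * (s * φ (r • x) + fderiv ℝ φ (r • x) (r • x))) volume 0 1 :=
    (intervalIntegral.intervalIntegrable_rpow' (by linarith)).mul_continuousOn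
      (((hφ.continuous.comp hray).const_mul s).add
        (((hφ.continuous_fderiv one_ne_zero).comp hray).clm_apply hray)).continuousOn
  rw [← integral_Ioc_eq_integral_Ioo, ← intervalIntegral.integral_of_le zero_le_one,
    intervalIntegral.integral_eq_sub_of_hasDerivAt_of_le zero_le_one hcont.continuousOn hderiv
      hint]
  simp [Real.zero_rpow hs.ne']

end Homogeneous

theorem integral_disk_homogeneous_mul_eq_zero {a : ℝ} (ha : -2 < a) {f φ : ℂ → ℝ}
    (hf : IsPosHomogeneous a f) (hφ : ContDiff ℝ 1 φ) (hs : tsupport φ ⊆ disk)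
    (hint : IntegrableOn (fun z ↦ f z * ((a + 2) * φ z + fderiv ℝ φ z z)) disk) :
    ∫ z in disk, f z * ((a + 2) * φ z + fderiv ℝ φ z z) = 0 := by
  rw [integral_ball_eq_integral_angle_radius hint]
  refine integral_eq_zero_of_ae (.of_forall fun θ ↦ ?_)
  set e : ℂ := Complex.exp (θ * Complex.I) with he
  have hφe : φ e = 0 := image_eq_zero_of_notMem_tsupport fun h ↦ by
    simpa [he, Complex.norm_exp_ofReal_mul_I] using hs h
  have hray : Set.EqOn
      (fun r : ℝ ↦ r • (f (circleMap 0 r θ) * ((a + 2) * φ (circleMap 0 r θ) +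
        fderiv ℝ φ (circleMap 0 r θ) (circleMap 0 r θ))))
      (fun r ↦ f e * (r ^ (a + 2 - 1) * ((a + 2) * φ (r • e) + fderiv ℝ φ (r • e) (r • e))))
      (Set.Ioo 0 1) := by
    intro r hr
    have hcircle : circleMap 0 r θ = r • e := by simp [circleMap, he]
    have hpow : r ^ (a + 2 - 1) = r * r ^ a := by
      rw [show a + 2 - 1 = a + 1 by ring, Real.rpow_add_one hr.1.ne', mul_comm]
    simp only [hcircle, hf hr.1 e, hpow, smul_eq_mul]
    ring
  refine (setIntegral_congr_fun measurableSet_Ioo hray).trans ?_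
  rw [integral_const_mul, integral_Ioo_rpow_mul_add_fderiv_self hφ (by linarith) e, hφe,
    mul_zero, Pi.zero_apply]

/-- The exponent `a + 2` comes from `div N = 2`; for `a > -2` the origin contributes nothing. -/
theorem IsPosHomogeneous.hasDistribDeriv_N {a : ℝ} (ha : -2 < a) {f : ℂ → ℝ}
    (hf : IsPosHomogeneous a f) (hf2 : MemLp f 2 (volume.restrict disk)) :
    HasDistribDeriv N (hf2.toLp f) (a • hf2.toLp f) := by
  rw [← MemLp.toLp_const_smul, hasDistribDeriv_toLp_iff]
  rintro φ ⟨hφ, -, hs⟩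
  have hφ1 : ContDiff ℝ 1 φ := hφ.of_le (by exact_mod_cast le_top)
  have hdiv (z : ℂ) : divergence (fun w ↦ φ w • N w) z = 2 * φ z + fderiv ℝ φ z z := by
    rw [divergence_smul (X := N) (hφ1.differentiable one_ne_zero z) differentiableAt_id,
      divergence_N, add_comm, mul_comm, N]
  have hφ' : Continuous fun z ↦ fderiv ℝ φ z z :=
    (hφ1.continuous_fderiv one_ne_zero).clm_apply continuous_id
  have hint : IntegrableOn (fun z ↦ a • f z * φ z) disk :=
    (hf2.const_smul a).integrable_mul (memLp_of_continuous hφ.continuous)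
  have hint' : IntegrableOn (fun z ↦ f z * (2 * φ z + fderiv ℝ φ z z)) disk :=
    hf2.integrable_mul (memLp_of_continuous ((hφ.continuous.const_mul 2).add hφ'))
  have hsum (z : ℂ) : a • f z * φ z + f z * (2 * φ z + fderiv ℝ φ z z) =
      f z * ((a + 2) * φ z + fderiv ℝ φ z z) := by
    rw [smul_eq_mul]
    ring
  have hint'' := hint.add hint'
  simp only [hdiv, Pi.smul_apply, Pi.add_def, hsum] at hint'' ⊢
  rw [eq_neg_iff_add_eq_zero, ← integral_add hint hint']
  simp only [hsum]
  exact integral_disk_homogeneous_mul_eq_zero ha hf hφ1 hs hint''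

/-! ### The functions `fk` -/

theorem fk_eq_radial_mul (k : ℕ) (z : ℂ) : fk k z = (‖z‖ ^ k)⁻¹ * (z ^ (k + 1)).re := by
  rw [fk, ← Complex.ofReal_pow, Complex.div_ofReal_re, div_eq_inv_mul]

theorem isPosHomogeneous_fk (k : ℕ) : IsPosHomogeneous 1 (fk k) := by
  intro t ht z
  rw [fk_eq_radial_mul, fk_eq_radial_mul, norm_smul, Real.norm_of_nonneg ht.le, smul_pow,
    Complex.smul_re, smul_eq_mul, Real.rpow_one, mul_pow, mul_inv, pow_succ]
  have := (pow_pos ht k).ne'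
  field_simp

theorem differentiableAt_fk (k : ℕ) {z : ℂ} (hz : z ≠ 0) : DifferentiableAt ℝ (fk k) z := by
  rw [funext (fk_eq_radial_mul k)]
  exact (((differentiableAt_id.norm ℝ hz).fun_pow k).fun_inv
    (pow_ne_zero _ (norm_ne_zero_iff.2 hz))).mul
      ((contDiff_re_pow (k + 1)).differentiable one_ne_zero z)

theorem abs_fk_le_norm (k : ℕ) (z : ℂ) : |fk k z| ≤ ‖z‖ := by
  rw [fk_eq_radial_mul, abs_mul, abs_inv, abs_of_nonneg (by positivity : 0 ≤ ‖z‖ ^ k)]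
  refine inv_mul_le_of_le_mul₀ (by positivity) (by positivity) ?_
  exact (Complex.abs_re_le_norm _).trans_eq (by rw [norm_pow, pow_succ])

theorem memLp_fk (k : ℕ) : MemLp (fk k) 2 (volume.restrict disk) := by
  have hmeas : Measurable (fk k) := by
    unfold fk
    fun_prop
  refine MemLp.of_bound hmeas.aestronglyMeasurable 1 ?_
  filter_upwards [ae_restrict_mem measurableSet_ball] with z hz
  exact (abs_fk_le_norm k z).trans (mem_ball_zero_iff.1 hz).le

theorem hasDistribDeriv_N_fk (k : ℕ) :
    HasDistribDeriv N ((memLp_fk k).toLp (fk k)) ((memLp_fk k).toLp (fk k)) := by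
  simpa only [one_smul] using (isPosHomogeneous_fk k).hasDistribDeriv_N (by norm_num) (memLp_fk k)

theorem norm_fk (k : ℕ) : ‖(memLp_fk k).toLp (fk k)‖ = Real.sqrt Real.pi / 2 := by
  have hradial : Set.EqOn (fun r : ℝ ↦ (r ^ k)⁻¹ ^ 2 * r ^ (2 * (k + 1) + 1)) (fun r ↦ r ^ 3)
      (Set.Ioo 0 1) := by
    intro r hr
    have := hr.1.ne'
    field_simp
    ring
  have hsq : ‖(memLp_fk k).toLp (fk k)‖ ^ 2 = Real.pi / 2 ^ 2 := by
    rw [norm_sq_toLp_of_eqOn_radial_mul_re_pow (w := fun r ↦ (r ^ k)⁻¹) k.succ_ne_zero _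
      fun z _ ↦ fk_eq_radial_mul k z, setIntegral_congr_fun measurableSet_Ioo hradial,
      integral_Ioo_zero_one_pow]
    norm_num
    ring
  rw [← Real.sqrt_sq (norm_nonneg _), hsq, Real.sqrt_div Real.pi_pos.le, Real.sqrt_sq zero_le_two]

theorem P_fk (k : ℕ) : P ((memLp_fk k).toLp (fk k)) =
    (2 * ((k : ℝ) + 2) / ((k : ℝ) + 4)) • reMonomial (k + 1) := by
  have hradial : Set.EqOn (fun r : ℝ ↦ (r ^ k)⁻¹ * r ^ (2 * (k + 1) + 1)) (fun r ↦ r ^ (k + 3))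
      (Set.Ioo 0 1) := by
    intro r hr
    have := hr.1.ne'
    field_simp
    ring
  rw [P_toLp_of_eqOn_radial_mul_re_pow (memLp_fk k) (w := fun r ↦ (r ^ k)⁻¹)
    fun z _ ↦ fk_eq_radial_mul k z, setIntegral_congr_fun measurableSet_Ioo hradial,
    integral_Ioo_zero_one_pow]
  congr 1
  push_cast
  field_simp
  ring

theorem P_fk_ae_eq (k : ℕ) : P ((memLp_fk k).toLp (fk k)) =ᵐ[volume.restrict disk]
    fun z : ℂ ↦ 2 * ((k : ℝ) + 2) / ((k : ℝ) + 4) * (z ^ (k + 1)).re := by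
  rw [P_fk, reMonomial, ← MemLp.toLp_const_smul]
  exact MemLp.coeFn_toLp _

theorem memH1_P_fk (k : ℕ) : MemH1 (P ((memLp_fk k).toLp (fk k))) := by
  rw [P_fk]
  exact (memH1_reMonomial (k + 1)).const_smul _

theorem sqrt_le_sobolevNorm_P_fk {k : ℕ} (hk : k ≠ 0) :
    Real.sqrt (Real.pi * ((k : ℝ) + 1) / 2) ≤ sobolevNorm (P ((memLp_fk k).toLp (fk k))) := by
  set c : ℝ := 2 * ((k : ℝ) + 2) / ((k : ℝ) + 4) with hc
  have hc1 : 1 ≤ c := by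
    rw [hc, one_le_div₀ (by positivity)]
    linarith [(k.cast_nonneg : (0 : ℝ) ≤ k)]
  have hderiv := ((hasDistribDeriv_X₁_reMonomial k).const_smul c).distribDeriv_eq
  have hnorm : ‖((k : ℝ) + 1) • reMonomial k‖ ^ 2 = Real.pi * ((k : ℝ) + 1) / 2 := by
    rw [norm_smul, mul_pow, norm_sq_reMonomial hk, Real.norm_of_nonneg (by positivity)]
    field_simp
  calc Real.sqrt (Real.pi * ((k : ℝ) + 1) / 2) = ‖((k : ℝ) + 1) • reMonomial k‖ := by
        rw [← hnorm, Real.sqrt_sq (norm_nonneg _)]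
    _ ≤ c * ‖((k : ℝ) + 1) • reMonomial k‖ := le_mul_of_one_le_left (norm_nonneg _) hc1
    _ = ‖distribDeriv X₁ (P ((memLp_fk k).toLp (fk k)))‖ := by
        rw [P_fk, hderiv, norm_smul c, Real.norm_of_nonneg (zero_le_one.trans hc1)]
    _ ≤ sobolevNorm (P ((memLp_fk k).toLp (fk k))) := norm_distribDeriv_X₁_le_sobolevNorm _

theorem tendsto_sobolevNorm_P_fk :
    Filter.Tendsto (fun k ↦ sobolevNorm (P ((memLp_fk k).toLp (fk k)))) Filter.atTop
      Filter.atTop := by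
  refine Filter.tendsto_atTop_mono' _ ((Filter.eventually_ne_atTop 0).mono fun k hk ↦
    sqrt_le_sobolevNorm_P_fk hk) (Real.tendsto_sqrt_atTop.comp ?_)
  exact ((Filter.tendsto_atTop_add_const_right _ 1 tendsto_natCast_atTop_atTop).const_mul_atTop
    Real.pi_pos).atTop_div_const two_pos

theorem not_exists_bound_fk :
    ¬ ∃ C : ℝ, ∀ k : ℕ, 1 ≤ k →
      sobolevNorm (P ((memLp_fk k).toLp (fk k))) ≤
        C * (‖distribDeriv N ((memLp_fk k).toLp (fk k))‖ + ‖(memLp_fk k).toLp (fk k)‖) := by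
  rintro ⟨C, hC⟩
  obtain ⟨k, hlt, hk⟩ := ((tendsto_sobolevNorm_P_fk.eventually_gt_atTop
    (C * Real.sqrt Real.pi)).and (Filter.eventually_ge_atTop 1)).exists
  have hle := hC k hk
  rw [(hasDistribDeriv_N_fk k).distribDeriv_eq, norm_fk, add_halves] at hle
  exact hlt.not_ge hle

end HarmonicBergman

theorem mainTheorem5 :
    ∃ hf : ∀ k : ℕ, MemLp (fk k) 2 (volume.restrict disk),
      (∀ k : ℕ,
        (∀ z : ℂ, z ≠ 0 → DifferentiableAt ℝ (fk k) z ∧ fderiv ℝ (fk k) z (N z) = fk k z) ∧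
        HasDistribDeriv N ((hf k).toLp (fk k)) ((hf k).toLp (fk k)) ∧
        ‖(hf k).toLp (fk k)‖ = Real.sqrt Real.pi / 2 ∧
        P ((hf k).toLp (fk k)) =ᵐ[volume.restrict disk]
          (fun z : ℂ ↦ 2 * ((k : ℝ) + 2) / ((k : ℝ) + 4) * (z ^ (k + 1)).re) ∧
        MemH1 (P ((hf k).toLp (fk k)))) ∧
      (¬ ∃ C : ℝ, ∀ k : ℕ, 1 ≤ k →
        sobolevNorm (P ((hf k).toLp (fk k))) ≤
          C * (‖distribDeriv N ((hf k).toLp (fk k))‖ + ‖(hf k).toLp (fk k)‖)) ∧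
      ¬ ∃ C : ℝ, ∀ f : L2Disk, (∃ g, HasDistribDeriv N f g) → MemH1 (P f) →
        sobolevNorm (P f) ≤ C * (‖distribDeriv N f‖ + ‖f‖) := by
  have hEuler (k : ℕ) {z : ℂ} (hz : z ≠ 0) : fderiv ℝ (fk k) z z = fk k z := by
    simpa only [one_mul] using (isPosHomogeneous_fk k).fderiv_self (differentiableAt_fk k hz)
  refine ⟨memLp_fk, fun k ↦ ⟨fun z hz ↦ ⟨differentiableAt_fk k hz, hEuler k hz⟩,
    hasDistribDeriv_N_fk k, norm_fk k, P_fk_ae_eq k, memH1_P_fk k⟩, not_exists_bound_fk, ?_⟩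
  rintro ⟨C, hC⟩
  exact not_exists_bound_fk ⟨C, fun k _ ↦ hC _ ⟨_, hasDistribDeriv_N_fk k⟩ (memH1_P_fk k)⟩
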